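/- Let $G$ be a finite simple graph on $n$ vertices whose independence number satisfies $\alpha(G)\le 2$. Let $P_4$ be the path on four vertices and let $K_3^e$ be the four-vertex graph consisting of a triangle together with a fourth vertex adjacent to exactly one vertex of the triangle. If $G$ has no induced subgraph isomorphic to $P_4$, or $G$ has no induced subgraph isomorphic to $K_3^e$, then $G$ contains the complete graph $K_{\lceil n/2\rceil}$ as an immersion; that is, with $H=K_{\lceil n/2\rceil}$, there are an injective map $\phi\colon V(H)\to V(G)$ and, for every edge $uv\in E(H)$, a path $P_{uv}$ in $G$ with endpoints $\phi(u)$ and $\phi(v)$, such that the paths $P_{uv}$ ($uv\in E(H)$) are pairwise edge-disjoint and no vertex of $\phi(V(H))$ is an interior vertex of any path $P_{uv}$. -/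

import Mathlib

/-- `G.ContainsImmersion H`: the graph `G` contains the graph `H` as an immersion. There are an
injection `φ` of the vertices of `H` into those of `G` and, for every edge `uv` of `H`, a path
`P u v` in `G` from `φ u` to `φ v` such that paths of distinct edges share no edge, and no branch
vertex `φ w` is an interior vertex of any of the paths. The path of an edge is recorded for both
orientations of that edge, `P v u` being `P u v` traversed backwards. -/
def SimpleGraph.ContainsImmersion {V W : Type*} (G : SimpleGraph V) (H : SimpleGraph W) : Prop :=
  ∃ (φ : W ↪ V) (P : ∀ u v : W, H.Adj u v → G.Walk (φ u) (φ v)),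
    (∀ u v (h : H.Adj u v), (P u v h).IsPath) ∧
    (∀ u v (h : H.Adj u v), P v u h.symm = (P u v h).reverse) ∧
    (∀ u v (h : H.Adj u v) u' v' (h' : H.Adj u' v'), s(u, v) ≠ s(u', v') →
      (P u v h).edges.Disjoint (P u' v' h').edges) ∧
    (∀ u v (h : H.Adj u v) w, φ w ∈ (P u v h).support → w = u ∨ w = v)

/-- `G.InducedFree H`: no induced subgraph of `G` is isomorphic to `H`. -/
def SimpleGraph.InducedFree {V W : Type*} (G : SimpleGraph V) (H : SimpleGraph W) : Prop :=
  ¬ H.IsIndContained G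

/-- The graph `K₃ᵉ`: a triangle `0 1 2` together with a further vertex `3` that is joined by a
pendant edge to the vertex `2` only. -/
def triangleWithPendantEdge : SimpleGraph (Fin 4) :=
  SimpleGraph.fromEdgeSet {s(0, 1), s(0, 2), s(1, 2), s(2, 3)}

namespace SimpleGraph

/-! Pass to the complement, which is triangle-free because α(G) ≤ 2. An independent set there
holding half of the vertices is a clique of G, whose edges already give the immersion. Excluding the
self-complementary P₄ makes every component of the complement complete bipartite, and the larger
sides form such a set. Excluding K₃ᵉ makes every two-edge path of the complement dominating, which
yields such a set unless the complement is a five-cycle; then G is a five-cycle too, a subdivided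
K₃. -/

/-- For a linearly ordered `W`, an immersion of the complete graph on `W` only needs a path for
each pair `u < v`. -/
theorem containsImmersion_completeGraph_of_lt {V W : Type*} [LinearOrder W] {G : SimpleGraph V}
    (φ : W ↪ V) (Q : ∀ u v : W, u < v → G.Walk (φ u) (φ v))
    (hpath : ∀ u v h, (Q u v h).IsPath)
    (hdisj : ∀ u v h u' v' h', (u, v) ≠ (u', v') →
      (Q u v h).edges.Disjoint (Q u' v' h').edges)
    (hsupp : ∀ u v h w, φ w ∈ (Q u v h).support → w = u ∨ w = v) :
    G.ContainsImmersion (completeGraph W) := by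
  have key : ∀ u v : W, (completeGraph W).Adj u v → ¬ u < v → v < u := fun u v h h' =>
    lt_of_le_of_ne (not_lt.mp h') (Ne.symm h)
  refine ⟨φ, fun u v h => if h' : u < v then Q u v h' else (Q v u (key u v h h')).reverse,
    ?_, ?_, ?_, ?_⟩
  · intro u v h
    dsimp only
    split_ifs with h'
    · exact hpath _ _ _
    · exact (hpath _ _ _).reverse
  · intro u v h
    rcases lt_or_gt_of_ne (show u ≠ v from h) with h' | h'
    · simp [h', h'.not_gt]
    · simp [h', h'.not_gt]
  · intro u v h u' v' h' hne e
    have h1 : ¬ (u = u' ∧ v = v') := by rintro ⟨rfl, rfl⟩; exact hne rfl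
    have h2 : ¬ (u = v' ∧ v = u') := by rintro ⟨rfl, rfl⟩; exact hne Sym2.eq_swap
    dsimp only
    split_ifs <;> (try simp only [Walk.edges_reverse, List.mem_reverse]) <;>
      refine fun a b => hdisj _ _ _ _ _ _ ?_ a b <;> simp only [ne_eq, Prod.mk.injEq] <;> tauto
  · intro u v h w hw
    dsimp only at hw
    split_ifs at hw with h'
    · exact hsupp _ _ _ _ hw
    · rw [Walk.support_reverse, List.mem_reverse] at hw
      exact (hsupp _ _ _ _ hw).symm

theorem IsClique.containsImmersion_completeGraph {V : Type*} {G : SimpleGraph V} {s : Finset V}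
    (hs : G.IsClique (s : Set V)) {m : ℕ} (hm : m ≤ s.card) :
    G.ContainsImmersion (completeGraph (Fin m)) := by
  let φ : Fin m ↪ V := (Fin.castLEEmb hm).trans
    (s.equivFin.symm.toEmbedding.trans (Function.Embedding.subtype _))
  have hφ : ∀ i, φ i ∈ s := fun i => (s.equivFin.symm (Fin.castLE hm i)).2
  have hadj : ∀ u v : Fin m, u < v → G.Adj (φ u) (φ v) := fun u v h =>
    hs (hφ u) (hφ v) (φ.injective.ne h.ne)
  refine containsImmersion_completeGraph_of_lt φ (fun u v h => (hadj u v h).toWalk)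
    (fun u v h => (hadj u v h).isPath_toWalk) ?_ ?_
  · intro u v h u' v' h' hne e h1 h2
    simp only [Walk.edges_cons, Walk.edges_nil, List.mem_singleton] at h1 h2
    subst h1
    simp only [Sym2.eq_iff, φ.injective.eq_iff] at h2
    rcases h2 with ⟨rfl, rfl⟩ | ⟨rfl, rfl⟩
    · exact hne rfl
    · exact lt_asymm h h'
  · intro u v h w hw
    simpa using hw

/-- A cycle `v₀ v₁ v₂ v₃ v₄` is a subdivided triangle. -/
theorem containsImmersion_completeGraph_three_of_five_cycle {V : Type*} {G : SimpleGraph V}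
    {v₀ v₁ v₂ v₃ v₄ : V} (hnodup : [v₀, v₁, v₂, v₃, v₄].Nodup) (h01 : G.Adj v₀ v₁)
    (h12 : G.Adj v₁ v₂) (h23 : G.Adj v₂ v₃) (h34 : G.Adj v₃ v₄) (h40 : G.Adj v₄ v₀) :
    G.ContainsImmersion (completeGraph (Fin 3)) := by
  simp only [List.nodup_cons, List.mem_cons, List.not_mem_nil, or_false, not_or] at hnodup
  obtain ⟨⟨n01, n02, n03, n04⟩, ⟨n12, n13, n14⟩, ⟨n23, n24⟩, n34, -⟩ := hnodup
  obtain ⟨φ, rfl, rfl, rfl⟩ : ∃ φ : Fin 3 ↪ V, φ 0 = v₀ ∧ φ 1 = v₁ ∧ φ 2 = v₂ := by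
    refine ⟨⟨![v₀, v₁, v₂], ?_⟩, rfl, rfl, rfl⟩
    intro i j h
    fin_cases i <;> fin_cases j <;> simp_all
  let Q : ∀ u v : Fin 3, u < v → G.Walk (φ u) (φ v)
    | 0, 1, _ => h01.toWalk
    | 1, 2, _ => h12.toWalk
    -- The only subdivided edge: it runs round the cycle through v₄ and v₃, avoiding the branch
    -- vertex v₁.
    | 0, 2, _ => .cons h40.symm (.cons h34.symm h23.symm.toWalk)
    | 0, 0, h | 1, 0, h | 1, 1, h | 2, 0, h | 2, 1, h | 2, 2, h => absurd h (by decide)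
  have q01 : Q 0 1 (by decide) = h01.toWalk := rfl
  have q12 : Q 1 2 (by decide) = h12.toWalk := rfl
  have q02 : Q 0 2 (by decide) = .cons h40.symm (.cons h34.symm h23.symm.toWalk) := rfl
  clear_value Q
  have hlt : ∀ u v : Fin 3, u < v →
      (u = 0 ∧ v = 1) ∨ (u = 1 ∧ v = 2) ∨ (u = 0 ∧ v = 2) := by decide
  refine containsImmersion_completeGraph_of_lt φ Q ?_ ?_ ?_
  · intro u v h
    rcases hlt u v h with ⟨rfl, rfl⟩ | ⟨rfl, rfl⟩ | ⟨rfl, rfl⟩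
    · exact q01 ▸ h01.isPath_toWalk
    · exact q12 ▸ h12.isPath_toWalk
    · rw [q02, Walk.isPath_def]
      simp only [Walk.support_cons, Walk.support_nil, List.nodup_cons, List.mem_cons,
        List.not_mem_nil, or_false]
      grind
  · intro u v h u' v' h' hne e
    rcases hlt u v h with ⟨rfl, rfl⟩ | ⟨rfl, rfl⟩ | ⟨rfl, rfl⟩ <;>
    rcases hlt u' v' h' with ⟨rfl, rfl⟩ | ⟨rfl, rfl⟩ | ⟨rfl, rfl⟩ <;>
    first
    | exact absurd rfl hne
    | (simp only [q01, q12, q02, Walk.edges_cons, Walk.edges_nil, List.mem_cons,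
        List.not_mem_nil, or_false]
       clear hlt hne q01 q12 q02
       induction e with | _ x y
       simp only [Sym2.eq_iff]
       grind)
  · intro u v h w hw
    have hw3 : w = 0 ∨ w = 1 ∨ w = 2 := by fin_cases w <;> simp
    rcases hlt u v h with ⟨rfl, rfl⟩ | ⟨rfl, rfl⟩ | ⟨rfl, rfl⟩ <;>
    simp only [q01, q12, q02, Walk.support_cons, Walk.support_nil, List.mem_cons,
        List.not_mem_nil, or_false] at hw <;> clear hlt q01 q12 q02 <;>
    rcases hw3 with rfl | rfl | rfl <;> grind

/-! ### Large independent sets in triangle-free graphs -/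

section IndependentSets

variable {V : Type*} {F : SimpleGraph V}

/-- If every walk of length three closes up to a four-cycle and there are no triangles, every
finite vertex set has an independent subset with at least half of its elements. -/
theorem exists_isIndepSet_half_of_adj_of_walk_three
    (hT : ∀ a b c, F.Adj a b → F.Adj b c → ¬ F.Adj a c)
    (hP : ∀ a b c d, F.Adj a b → F.Adj b c → F.Adj c d → F.Adj a d) (s : Finset V) :
    ∃ t ⊆ s, F.IsIndepSet (t : Set V) ∧ s.card ≤ 2 * t.card := by
  classical
  induction s using Finset.strongInduction with
  | H s ih =>
  by_cases hE : ∃ a ∈ s, ∃ b ∈ s, F.Adj a b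
  · obtain ⟨a, ha, b, hb, hab⟩ := hE
    set A := s.filter (F.Adj a) with hA
    set B := s.filter (F.Adj b) with hB
    have hAB : Disjoint A B := by
      rw [Finset.disjoint_left]
      intro x hx hy
      simp only [hA, hB, Finset.mem_filter] at hx hy
      exact hT a b x hab hy.2 hx.2
    have hCs : A ∪ B ⊆ s := Finset.union_subset (Finset.filter_subset _ _)
      (Finset.filter_subset _ _)
    obtain ⟨t, hts, hti, htc⟩ := ih (s \ (A ∪ B))
      (Finset.sdiff_ssubset hCs ⟨b, by simp [hA, hb, hab]⟩)
    have hcard : s.card = (s \ (A ∪ B)).card + (A.card + B.card) := by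
      rw [← Finset.card_union_of_disjoint hAB, Finset.card_sdiff_add_card_eq_card hCs]
    -- An edge from `C` to `p ∈ t` would complete a walk y, x, q, p, forcing `p` to be a neighbour
    -- of `y`, hence already removed. So the larger of `A` and `B` can be added to `t`.
    have ext : ∀ x y, F.Adj x y → ∀ C : Finset V, C = s.filter (F.Adj x) → C ⊆ A ∪ B →
        (∀ z ∈ s, F.Adj y z → z ∈ A ∪ B) → s.card ≤ (s \ (A ∪ B)).card + 2 * C.card →
        ∃ t ⊆ s, F.IsIndepSet (t : Set V) ∧ s.card ≤ 2 * t.card := by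
      intro x y hxy C hC hCAB hy hle
      have hd : Disjoint t C := Finset.disjoint_left.mpr fun z hz hzC =>
        (Finset.mem_sdiff.mp (hts hz)).2 (hCAB hzC)
      have hcross : ∀ p ∈ t, ∀ q ∈ C, ¬ F.Adj q p := by
        intro p hp q hq hadj
        have hp' := Finset.mem_sdiff.mp (hts hp)
        rw [hC, Finset.mem_filter] at hq
        exact hp'.2 (hy p hp'.1 (hP y x q p hxy.symm hq.2 hadj))
      refine ⟨t ∪ C, Finset.union_subset (hts.trans Finset.sdiff_subset) (hCAB.trans hCs), ?_, ?_⟩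
      · intro p hp q hq hpq
        simp only [Finset.coe_union, Set.mem_union, Finset.mem_coe] at hp hq
        rcases hp with hp | hp <;> rcases hq with hq | hq
        · exact hti hp hq hpq
        · exact fun h => hcross p hp q hq h.symm
        · exact hcross q hq p hp
        · rw [hC, Finset.mem_filter] at hp hq
          exact fun h => hT x p q hp.2 h hq.2
      · rw [Finset.card_union_of_disjoint hd]
        omega
    rcases le_total A.card B.card with h | h
    · exact ext b a hab.symm B hB Finset.subset_union_right
        (fun z hz h => Finset.mem_union_left _ (Finset.mem_filter.mpr ⟨hz, h⟩)) (by omega)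
    · exact ext a b hab A hA Finset.subset_union_left
        (fun z hz h => Finset.mem_union_right _ (Finset.mem_filter.mpr ⟨hz, h⟩)) (by omega)
  · push Not at hE
    exact ⟨s, subset_rfl, fun x hx y hy _ => hE x hx y hy, by omega⟩

/-- Edges form a matching, so a walk of length three only retraces one edge. -/
theorem exists_isIndepSet_half_of_subsingleton_neighborSet [Fintype V]
    (h : ∀ a b c, F.Adj b a → F.Adj b c → a = c) :
    ∃ t : Finset V, F.IsIndepSet (t : Set V) ∧ Fintype.card V ≤ 2 * t.card := by
  classical
  obtain ⟨t, -, ht, hc⟩ := exists_isIndepSet_half_of_adj_of_walk_three (F := F)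
    (fun a b c hab hbc hac => hbc.ne (h b a c hab hac))
    (fun a b c d hab hbc hcd => h b c d hbc.symm hcd ▸ hab) Finset.univ
  exact ⟨t, ht, by simpa using hc⟩

/-- In a triangle-free graph in which every vertex is adjacent to, or the centre of, each path with
two edges, either some independent set contains half of the vertices or the graph is a
five-cycle. -/
theorem exists_isIndepSet_half_or_five_cycle [Fintype V]
    (hT : ∀ a b c, F.Adj a b → F.Adj b c → ¬ F.Adj a c)
    (hK : ∀ a b c d, F.Adj b a → F.Adj b c → a ≠ c → d ≠ b → F.Adj d a ∨ F.Adj d b ∨ F.Adj d c) :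
    (∃ t : Finset V, F.IsIndepSet (t : Set V) ∧ Fintype.card V ≤ 2 * t.card) ∨
    ∃ a b c d e : V, F.Adj b a ∧ F.Adj b c ∧ F.Adj a d ∧ F.Adj c e ∧ F.Adj d e ∧
      ∀ x, x = a ∨ x = b ∨ x = c ∨ x = d ∨ x = e := by
  classical
  by_cases hI : ∃ t : Finset V, F.IsIndepSet (t : Set V) ∧ Fintype.card V ≤ 2 * t.card
  · exact Or.inl hI
  refine Or.inr ?_
  -- Otherwise neighbours and non-neighbours of `b` are both independent, and one class has half of
  -- the vertices.
  have hM : ∀ b, ∃ d e, F.Adj d e ∧ ¬ F.Adj b d ∧ ¬ F.Adj b e := by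
    intro b
    by_contra! hcon
    refine hI ?_
    have hsum := Finset.card_filter_add_card_filter_not (s := Finset.univ) (F.Adj b)
    rw [Finset.card_univ] at hsum
    rcases le_total (Finset.univ.filter fun x => ¬ F.Adj b x).card
      (Finset.univ.filter (F.Adj b)).card with h | h
    · refine ⟨Finset.univ.filter (F.Adj b), ?_, by omega⟩
      intro x hx y hy _ hxy
      simp only [Finset.coe_filter, Finset.mem_univ, true_and, Set.mem_ofPred_eq] at hx hy
      exact hT b x y hx hxy hy
    · refine ⟨Finset.univ.filter fun x => ¬ F.Adj b x, ?_, by omega⟩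
      intro x hx y hy _ hxy
      simp only [Finset.coe_filter, Finset.mem_univ, true_and, Set.mem_ofPred_eq] at hx hy
      exact hy (hcon x y hxy hx)
  -- Degrees are at most two: given three neighbours of `b`, each end of an edge `d e` missing N(b)
  -- is adjacent to at least two of them, so the ends share one and close a triangle.
  have hdeg : ∀ b x y z, F.Adj b x → F.Adj b y → F.Adj b z → x = y ∨ x = z ∨ y = z := by
    intro b x y z hx hy hz
    by_contra! hne
    obtain ⟨d, e, hde, hd, he⟩ := hM b
    have hdb : d ≠ b := by rintro rfl; exact he hde
    have heb : e ≠ b := by rintro rfl; exact hd hde.symm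
    have hd' : ¬ F.Adj d b := fun h => hd h.symm
    have he' : ¬ F.Adj e b := fun h => he h.symm
    have hno : ∀ w, F.Adj d w → ¬ F.Adj e w := fun w h h' => hT d e w hde h' h
    have := hK x b y d hx hy hne.1 hdb
    have := hK x b z d hx hz hne.2.1 hdb
    have := hK y b z d hy hz hne.2.2 hdb
    have := hK x b y e hx hy hne.1 heb
    have := hK x b z e hx hz hne.2.1 heb
    have := hK y b z e hy hz hne.2.2 heb
    have := hno x
    have := hno y
    have := hno z
    clear hT hK hI hM
    grind
  by_cases h2 : ∃ a b c, F.Adj b a ∧ F.Adj b c ∧ a ≠ c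
  · obtain ⟨a, b, c, hba, hbc, hac⟩ := h2
    obtain ⟨d, e, hde, hd, he⟩ := hM b
    have hdb : d ≠ b := by rintro rfl; exact he hde
    have heb : e ≠ b := by rintro rfl; exact hd hde.symm
    have hd' : ¬ F.Adj d b := fun h => hd h.symm
    have he' : ¬ F.Adj e b := fun h => he h.symm
    -- A further vertex would be adjacent to `a`, `b` or `c`, each of which already has two
    -- neighbours on the cycle.
    have main : ∀ a c, F.Adj b a → F.Adj b c → a ≠ c → F.Adj a d → F.Adj c e →
        ∀ x, x = a ∨ x = b ∨ x = c ∨ x = d ∨ x = e := by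
      intro a c hba hbc hac had hce x
      by_contra! hx
      have hxb : ¬ F.Adj x b := fun h => by
        have := hdeg b a c x hba hbc h.symm
        have := hx.1.symm
        have := hx.2.2.1.symm
        tauto
      rcases hK a b c x hba hbc hac hx.2.1 with h | h | h
      · rcases hdeg a b d x hba.symm had h.symm with h | h | h
        · exact hdb h.symm
        · exact hx.2.1 h.symm
        · exact hx.2.2.2.1 h.symm
      · exact hxb h
      · rcases hdeg c b e x hbc.symm hce h.symm with h | h | h
        · exact heb h.symm
        · exact hx.2.1 h.symm
        · exact hx.2.2.2.2 h.symm
    have hno : ∀ w, F.Adj d w → ¬ F.Adj e w := fun w h h' => hT d e w hde h' h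
    have h1 := hK a b c d hba hbc hac hdb
    have h2 := hK a b c e hba hbc hac heb
    have h3 := hno a
    have h4 := hno c
    have h5 : (F.Adj d a ∧ F.Adj e c) ∨ (F.Adj d c ∧ F.Adj e a) := by tauto
    rcases h5 with ⟨h, h'⟩ | ⟨h, h'⟩
    · exact ⟨a, b, c, d, e, hba, hbc, h.symm, h'.symm, hde,
        main a c hba hbc hac h.symm h'.symm⟩
    · exact ⟨c, b, a, d, e, hbc, hba, h.symm, h'.symm, hde,
        main c a hbc hba hac.symm h.symm h'.symm⟩
  · push Not at h2
    exact absurd (exists_isIndepSet_half_of_subsingleton_neighborSet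
      fun a b c hba hbc => h2 a b c hba hbc) hI

end IndependentSets

/-! ### Translating the hypotheses on G to its complement -/

section Complement

variable {V : Type*} {G : SimpleGraph V}

theorem compl_triangle_free_of_indepNum_le_two [Fintype V] (hα : G.indepNum ≤ 2) (a b c : V)
    (hab : Gᶜ.Adj a b) (hbc : Gᶜ.Adj b c) : ¬ Gᶜ.Adj a c := by
  classical
  intro hac
  have hind : G.IsIndepSet (({a, b, c} : Finset V) : Set V) := by
    rw [← isClique_compl]
    exact (is3Clique_triple_iff.mpr ⟨hab, hac, hbc⟩).isClique
  have := hind.card_le_indepNum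
  rw [Finset.card_eq_three.mpr ⟨a, b, c, hab.ne, hac.ne, hbc.ne, rfl⟩] at this
  omega

theorem InducedFree.compl_adj_of_walk_three (hG : G.InducedFree (pathGraph 4))
    (hT : ∀ a b c, Gᶜ.Adj a b → Gᶜ.Adj b c → ¬ Gᶜ.Adj a c) (a b c d : V)
    (hab : Gᶜ.Adj a b) (hbc : Gᶜ.Adj b c) (hcd : Gᶜ.Adj c d) : Gᶜ.Adj a d := by
  by_contra had
  have hac := hT a b c hab hbc
  have hbd := hT b c d hbc hcd
  have hne_ac : a ≠ c := by rintro rfl; exact had hcd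
  have hne_bd : b ≠ d := by rintro rfl; exact had hab
  have hne_ad : a ≠ d := by rintro rfl; exact hac hcd.symm
  simp only [compl_adj, not_and, not_not] at *
  have gac := hac hne_ac
  have gbd := hbd hne_bd
  have gad := had hne_ad
  have gca := gac.symm
  have gdb := gbd.symm
  have gda := gad.symm
  have nba : ¬ G.Adj b a := fun h => hab.2 h.symm
  have ncb : ¬ G.Adj c b := fun h => hbc.2 h.symm
  have ndc : ¬ G.Adj d c := fun h => hcd.2 h.symm
  -- The complement of the path a b c d is the path b d a c.
  refine hG ⟨⟨⟨![b, d, a, c], ?_⟩, ?_⟩⟩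
  · intro i j h
    fin_cases i <;> fin_cases j <;> simp_all
  · intro i j
    change G.Adj (![b, d, a, c] i) (![b, d, a, c] j) ↔ _
    fin_cases i <;> fin_cases j <;> simp_all [pathGraph_adj]

/-- The complement of K₃ᵉ is a two-edge path plus an isolated vertex: here `a c d` would be the
triangle and `b` the pendant vertex attached to `d`. -/
theorem InducedFree.compl_adj_of_path_two (hG : G.InducedFree triangleWithPendantEdge)
    (hT : ∀ a b c, Gᶜ.Adj a b → Gᶜ.Adj b c → ¬ Gᶜ.Adj a c) (a b c d : V)
    (hba : Gᶜ.Adj b a) (hbc : Gᶜ.Adj b c) (hac : a ≠ c) (hdb : d ≠ b) :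
    Gᶜ.Adj d a ∨ Gᶜ.Adj d b ∨ Gᶜ.Adj d c := by
  by_contra! hd
  obtain ⟨hda, hdb', hdc⟩ := hd
  have hac' := hT a b c hba.symm hbc
  have hne_da : d ≠ a := by rintro rfl; exact hdb' hba.symm
  have hne_dc : d ≠ c := by rintro rfl; exact hdb' hbc.symm
  simp only [compl_adj, not_and, not_not] at *
  have gac := hac' hac
  have gda := hda hne_da
  have gdb := hdb' hdb
  have gdc := hdc hne_dc
  have gca := gac.symm
  have gad := gda.symm
  have gbd := gdb.symm
  have gcd := gdc.symm
  have nab : ¬ G.Adj a b := fun h => hba.2 h.symm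
  have ncb : ¬ G.Adj c b := fun h => hbc.2 h.symm
  refine hG ⟨⟨⟨![a, c, d, b], ?_⟩, ?_⟩⟩
  · intro i j h
    fin_cases i <;> fin_cases j <;> simp_all
  · intro i j
    change G.Adj (![a, c, d, b] i) (![a, c, d, b] j) ↔ _
    fin_cases i <;> fin_cases j <;> simp_all [triangleWithPendantEdge]

end Complement

end SimpleGraph

theorem mainTheorem7 {V : Type*} [Fintype V] (G : SimpleGraph V) (hα : G.indepNum ≤ 2)
    (hfree : G.InducedFree (SimpleGraph.pathGraph 4) ∨ G.InducedFree triangleWithPendantEdge) :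
    G.ContainsImmersion (SimpleGraph.completeGraph (Fin ⌈(Fintype.card V : ℚ) / 2⌉₊)) := by
  classical
  have hT := SimpleGraph.compl_triangle_free_of_indepNum_le_two hα
  have half : ∀ t : Finset V, Gᶜ.IsIndepSet (t : Set V) → Fintype.card V ≤ 2 * t.card →
      G.ContainsImmersion (SimpleGraph.completeGraph (Fin ⌈(Fintype.card V : ℚ) / 2⌉₊)) := by
    intro t ht hc
    refine (G.isIndepSet_compl.mp ht).containsImmersion_completeGraph (Nat.ceil_le.mpr ?_)
    have : (Fintype.card V : ℚ) ≤ 2 * t.card := by exact_mod_cast hc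
    linarith
  rcases hfree with h | h
  · obtain ⟨t, -, ht, hc⟩ := SimpleGraph.exists_isIndepSet_half_of_adj_of_walk_three hT
      (h.compl_adj_of_walk_three hT) Finset.univ
    exact half t ht (by simpa using hc)
  · rcases SimpleGraph.exists_isIndepSet_half_or_five_cycle hT (h.compl_adj_of_path_two hT) with
      ⟨t, ht, hc⟩ | ⟨a, b, c, d, e, hba, hbc, had, hce, hde, hall⟩
    · exact half t ht hc
    -- The complement is the cycle b a d e c; its five chords are edges of G and form the cycle b d
    -- c a e.
    · have hac := hT a b c hba.symm hbc
      have hbd := hT b a d hba had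
      have hbe := hT b c e hbc hce
      have hae := hT a d e had hde
      have hcd := hT c e d hce hde.symm
      have hnodup : [b, d, c, a, e].Nodup := by
        have := hba.ne
        have := hbc.ne
        have := had.ne
        have := hce.ne
        have := hde.ne
        have : b ≠ d := by rintro rfl; exact hbe hde
        have : b ≠ e := by rintro rfl; exact hbd hde.symm
        have : a ≠ c := by rintro rfl; exact hae hce
        have : a ≠ e := by rintro rfl; exact hac hce.symm
        have : c ≠ d := by rintro rfl; exact hac had
        simp only [List.nodup_cons, List.mem_cons, List.not_mem_nil, or_false, not_or]
        grind
      have huniv : (Finset.univ : Finset V) = [b, d, c, a, e].toFinset := by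
        ext x
        have := hall x
        simp only [Finset.mem_univ, List.mem_toFinset, List.mem_cons, List.not_mem_nil, or_false,
          true_iff]
        tauto
      have hcard : Fintype.card V = 5 := by
        rw [← Finset.card_univ, huniv, List.toFinset_card_of_nodup hnodup]
        rfl
      have hceil : ⌈(Fintype.card V : ℚ) / 2⌉₊ = 3 := by
        rw [hcard, Nat.ceil_eq_iff (by norm_num)]
        norm_num
      rw [hceil]
      have adj : ∀ x y, x ≠ y → ¬ Gᶜ.Adj x y → G.Adj x y := fun x y hne h => by
        by_contra h'
        exact h ((G.compl_adj x y).mpr ⟨hne, h'⟩)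
      have hn := hnodup
      simp only [List.nodup_cons, List.mem_cons, List.not_mem_nil, or_false, not_or] at hn
      obtain ⟨⟨n1, n2, n3, n4⟩, ⟨n5, n6, n7⟩, ⟨n8, n9⟩, n10, -⟩ := hn
      exact SimpleGraph.containsImmersion_completeGraph_three_of_five_cycle hnodup
        (adj b d n1 hbd) (adj d c n5 fun h => hcd h.symm) (adj c a n8 fun h => hac h.symm)
        (adj a e n10 hae) (adj b e n4 hbe).symm
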